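/- Let $H$ be a separable real Hilbert space and let $(\Omega,\mathcal F,P)$ be a complete probability space. Let $\alpha\in\,]0,1[$, and let $T\colon H\to H$ be $\alpha$-averaged, i.e. $\mathrm{Id}+\alpha^{-1}(T-\mathrm{Id})$ is $1$-Lipschitzian, with $\mathrm{Fix}\,T=\{z\in H: Tz=z\}\neq\varnothing$. Let $x_0\in L^2(\Omega,\mathcal F,P;H)$ and, for every $n\in\mathbb N$, let $$x_{n+1}=x_n+\mu_n\,(Tx_n+e_n-x_n),$$ where $e_n\in L^2(\Omega,\mathcal F,P;H)$ and $\mu_n$ is a real random variable with $\mu_n\in\,]0,1/\alpha[$ almost surely. Set $\mathcal X_n=\sigma(x_0,\dots,x_n)$. Suppose that $\sum_{n\in\mathbb N}E\big(\mu_n(1-\alpha\mu_n)\big)=+\infty$ and that, for every $n\in\mathbb N$, $\mu_n$ is independent of $\sigma(e_n,x_0,\dots,x_n)$. An operator $A\colon H\to H$ is called demiregular at $z\in H$ if $u_n\to z$ (strongly) for every sequence $(u_n)_{n\in\mathbb N}$ in $H$ such that $u_n\rightharpoonup z$ (weakly) and $Au_n\to Az$. Then there exists a $\mathrm{Fix}\,T$-valued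 random variable $x$ such that the following hold. 1. Suppose that $E(\|e_n\|^2\mid\mathcal X_n)\to 0$ almost surely and $\sum_{n\in\mathbb N}(E\mu_n)\sqrt{E(\|e_n\|^2\mid\mathcal X_n)}<+\infty$ almost surely. Then: - (a) $Tx_n-x_n\to 0$ strongly almost surely. - (b) $x_n\rightharpoonup x$ weakly almost surely. - (c) If $T-\mathrm{Id}$ is demiregular at every point of $\mathrm{Fix}\,T$, then $x_n\to x$ strongly almost surely. 2. Suppose that $E\|e_n\|^2\to 0$ and $\sum_{n\in\mathbb N}\sqrt{E(\mu_n^2)\,E\|e_n\|^2}<+\infty$. Then: - (a) $Tx_n-x_n\to 0$ strongly in $L^1(\Omega,\mathcal F,P;H)$ and strongly almost surely. - (b) $x\in L^2(\Omega,\mathcal F,P;\mathrm{Fix}\,T)$, and $(x_n)_{n\in\mathbb N}$ converges to $x$ weakly in $L^2(\Omega,\mathcal F,P;H)$ and weakly almost surely. - (c) If $T-\mathrm{Id}$ is demiregular at every point of $\mathrm{Fix}\,T$, then $(x_n)_{n\in\mathbb N}$ converges to $x$ strongly in $L^2(\Omega,\mathcal F,P;H)$ and strongly almost surely. -/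

import Mathlib

open MeasureTheory ProbabilityTheory Filter Topology
open scoped ENNReal

namespace StochKM

section Deterministic

variable {H : Type*} [NormedAddCommGroup H] [InnerProductSpace ℝ H]

/-- Weak convergence of a sequence in a real Hilbert space. -/
def WeakTendsto (u : ℕ → H) (z : H) : Prop :=
  ∀ y : H, Tendsto (fun n => inner ℝ (u n) y) atTop (𝓝 (inner ℝ z y))

/-- `T` is `α`-averaged: `Id + α⁻¹ (T - Id)` is nonexpansive. -/
def IsAveraged (α : ℝ) (T : H → H) : Prop :=
  LipschitzWith 1 (fun z => z + α⁻¹ • (T z - z))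

/-- `A` is demiregular at `z`: whenever `uₙ ⇀ z` and `A uₙ → A z`, one has `uₙ → z`. -/
def DemiregularAt (A : H → H) (z : H) : Prop :=
  ∀ u : ℕ → H, WeakTendsto u z → Tendsto (fun n => A (u n)) atTop (𝓝 (A z)) →
    Tendsto u atTop (𝓝 z)

end Deterministic

section Random

variable {Ω H : Type*} [NormedAddCommGroup H]

/-- The σ-algebra generated by `x₀, …, xₙ`. -/
@[reducible] def sigmaUpTo [MeasurableSpace H] (x : ℕ → Ω → H) (n : ℕ) : MeasurableSpace Ω :=
  ⨆ j ∈ Finset.range (n + 1), MeasurableSpace.comap (x j) inferInstance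

variable [MeasurableSpace Ω]

/-- Strong almost sure convergence. -/
def AsTendsto (P : Measure Ω) (x : ℕ → Ω → H) (xlim : Ω → H) : Prop :=
  ∀ᵐ ω ∂P, Tendsto (fun n => x n ω) atTop (𝓝 (xlim ω))

/-- Strong convergence in `L^p(Ω, P; H)`; all the functions involved belong to that space. -/
def LpTendsto (p : ℝ≥0∞) (P : Measure Ω) (x : ℕ → Ω → H) (xlim : Ω → H) : Prop :=
  (∀ n, MemLp (x n) p P) ∧ MemLp xlim p P ∧
    Tendsto (fun n => eLpNorm (x n - xlim) p P) atTop (𝓝 0)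

variable [InnerProductSpace ℝ H]

/-- Weak almost sure convergence. -/
def AsWeakTendsto (P : Measure Ω) (x : ℕ → Ω → H) (xlim : Ω → H) : Prop :=
  ∀ᵐ ω ∂P, WeakTendsto (fun n => x n ω) (xlim ω)

/-- Weak convergence in the Hilbert space `L²(Ω, P; H)`, whose scalar product is
`(y, z) ↦ E⟨y, z⟩`; all the functions involved belong to that space. -/
def L2WeakTendsto (P : Measure Ω) (x : ℕ → Ω → H) (xlim : Ω → H) : Prop :=
  (∀ n, MemLp (x n) 2 P) ∧ MemLp xlim 2 P ∧
    ∀ y : Ω → H, MemLp y 2 P →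
      Tendsto (fun n => ∫ ω, inner ℝ (x n ω) (y ω) ∂P) atTop
        (𝓝 (∫ ω, inner ℝ (xlim ω) (y ω) ∂P))

end Random

end StochKM

/-! With `R = Id + α⁻¹(T - Id)` nonexpansive, the distances `‖xₙ - z‖` to a fixed point and the
residuals `‖T xₙ - xₙ‖` grow at each step by at most a constant times `μₙ‖eₙ‖`. Both therefore
converge pathwise once these errors are almost surely summable. Moreover a step lowers `‖xₙ - z‖²`
by `α⁻¹μₙ(1 - αμₙ)‖T xₙ - xₙ‖²`, up to error terms. Integrated over an event of the past,
independence replaces the random weight by its mean; since the means have a divergent sum, the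
residuals tend to zero. Opial's argument (`IsAveraged.exists_weakTendsto`) then gives a weak limit
in `Fix T`.

Error summability comes from localization rather than supermartingale convergence
(`IsNoisyKM.ae_summable_error_and_tendsto_residual`): on decreasing events where the past
conditional errors stay below `K`, the expected errors are summable, and almost every path remains
in such events forever for some `K`. Under the conditions in expectation the events are the whole
space, and `∑ μₙ‖eₙ‖` lies in `L²`. The iterates are then dominated in `L²`
(`IsNoisyKM.exists_memLp_bound`), so almost sure convergence passes to `L¹` and `L²`. -/

namespace StochKM

/-! ### One-step estimates for averaged operators. -/

section Averaged

variable {H : Type*} [NormedAddCommGroup H] {α : ℝ} {T : H → H}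

theorem IsAveraged.norm_le [InnerProductSpace ℝ H] (hT : IsAveraged α T) (x y : H) :
    ‖(x + α⁻¹ • (T x - x)) - (y + α⁻¹ • (T y - y))‖ ≤ ‖x - y‖ := by
  simpa [dist_eq_norm] using hT.dist_le_mul x y

variable [InnerProductSpace ℝ H]

theorem IsAveraged.continuous (hα : 0 < α) (hT : IsAveraged α T) : Continuous T := by
  have h : T = fun z => z + α • ((z + α⁻¹ • (T z - z)) - z) := by
    funext z
    rw [add_sub_cancel_left, smul_inv_smul₀ hα.ne', add_sub_cancel]
  rw [h]
  have := LipschitzWith.continuous hT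
  fun_prop

/-- Expanding `‖R x - z‖² ≤ ‖x - z‖²` gives `2⟨x - z, T x - x⟩ ≤ -α⁻¹‖T x - x‖²`. Multiplying by `m`
leaves the gain `α⁻¹m - m² = α⁻¹m(1 - αm)`. -/
theorem IsAveraged.norm_sq_relax_le (hα : 0 < α) (hT : IsAveraged α T) {z : H}
    (hz : T z = z) (x : H) {m : ℝ} (hm : 0 ≤ m) :
    ‖x + m • (T x - x) - z‖ ^ 2 + α⁻¹ * (m * (1 - α * m)) * ‖T x - x‖ ^ 2 ≤ ‖x - z‖ ^ 2 := by
  have h := hT.norm_le x z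
  rw [hz, sub_self, smul_zero, add_zero] at h
  have e1 : x + α⁻¹ • (T x - x) - z = (x - z) + α⁻¹ • (T x - x) := by abel
  have e2 : x + m • (T x - x) - z = (x - z) + m • (T x - x) := by abel
  rw [e1] at h
  have h2 := pow_le_pow_left₀ (norm_nonneg _) h 2
  rw [norm_add_sq_real, inner_smul_right, norm_smul, mul_pow, Real.norm_eq_abs, sq_abs] at h2
  rw [e2, norm_add_sq_real, inner_smul_right, norm_smul, mul_pow, Real.norm_eq_abs, sq_abs]
  set i := inner ℝ (x - z) (T x - x)
  set q := ‖T x - x‖ ^ 2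
  have h3 : α⁻¹ * (2 * i + α⁻¹ * q) ≤ 0 := by nlinarith
  have h4 : 2 * i + α⁻¹ * q ≤ 0 := by
    by_contra hc
    exact absurd h3 (not_le.2 (mul_pos (inv_pos.2 hα) (not_le.1 hc)))
  have h5 : m * (2 * i + α⁻¹ * q) ≤ 0 := mul_nonpos_of_nonneg_of_nonpos hm h4
  have h6 : α⁻¹ * (m * (1 - α * m)) * q = m * α⁻¹ * q - m ^ 2 * q := by
    field_simp
  rw [h6]
  nlinarith

theorem IsAveraged.norm_relax_le (hα : 0 < α) (hT : IsAveraged α T) {z : H}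
    (hz : T z = z) (x : H) {m : ℝ} (hm : m ∈ Set.Ioo 0 (1 / α)) :
    ‖x + m • (T x - x) - z‖ ≤ ‖x - z‖ := by
  have h := hT.norm_sq_relax_le hα hz x hm.1.le
  have h1 : 0 ≤ 1 - α * m := by
    have := (lt_div_iff₀ hα).1 hm.2
    linarith
  have h2 : 0 ≤ α⁻¹ * (m * (1 - α * m)) * ‖T x - x‖ ^ 2 := by
    have := hm.1.le
    positivity
  exact (pow_le_pow_iff_left₀ (norm_nonneg _) (norm_nonneg _) two_ne_zero).1 (by linarith)

theorem norm_relax_add_error_sub (x e z : H) {m : ℝ} (hm : 0 ≤ m) :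
    ‖x + m • (T x + e - x) - z‖ ≤ ‖x + m • (T x - x) - z‖ + m * ‖e‖ := by
  have h : x + m • (T x + e - x) - z = (x + m • (T x - x) - z) + m • e := by
    module
  rw [h]
  refine (norm_add_le _ _).trans_eq ?_
  rw [norm_smul, Real.norm_of_nonneg hm]

theorem IsAveraged.norm_step_le (hα : 0 < α) (hT : IsAveraged α T) {z : H}
    (hz : T z = z) (x e : H) {m : ℝ} (hm : m ∈ Set.Ioo 0 (1 / α)) :
    ‖x + m • (T x + e - x) - z‖ ≤ ‖x - z‖ + m * ‖e‖ :=
  (norm_relax_add_error_sub x e z hm.1.le).trans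
    (by gcongr; exact hT.norm_relax_le hα hz x hm)

theorem IsAveraged.norm_sq_step_le (hα : 0 < α) (hT : IsAveraged α T) {z : H}
    (hz : T z = z) (x e : H) {m : ℝ} (hm : m ∈ Set.Ioo 0 (1 / α)) :
    ‖x + m • (T x + e - x) - z‖ ^ 2 + α⁻¹ * (m * (1 - α * m)) * ‖T x - x‖ ^ 2
      ≤ ‖x - z‖ ^ 2 + 2 * (‖x - z‖ * (m * ‖e‖)) + (m * ‖e‖) ^ 2 := by
  have h1 := hT.norm_sq_relax_le hα hz x hm.1.le
  have h2 := hT.norm_relax_le hα hz x hm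
  have h3 := norm_relax_add_error_sub (T := T) x e z hm.1.le
  have h4 := pow_le_pow_left₀ (norm_nonneg _) h3 2
  have h5 : 0 ≤ m * ‖e‖ := mul_nonneg hm.1.le (norm_nonneg _)
  have h6 := mul_le_mul_of_nonneg_right h2 h5
  nlinarith

/-- Here `α⁻¹(T x' - x') = (R x' - R x) + (R x - x')`. The first term costs at most `m‖T x - x‖ +
m‖e‖` and the second `(α⁻¹ - m)‖T x - x‖ + m‖e‖`, so the `m‖T x - x‖` terms cancel. -/
theorem IsAveraged.norm_residual_step_le (hα : 0 < α) (hT : IsAveraged α T)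
    (x e : H) {m : ℝ} (hm : m ∈ Set.Ioo 0 (1 / α)) :
    ‖T (x + m • (T x + e - x)) - (x + m • (T x + e - x))‖ ≤ ‖T x - x‖ + 2 * α * (m * ‖e‖) := by
  set x' := x + m • (T x + e - x) with hx'
  have h1 := hT.norm_le x' x
  have h2 : α⁻¹ • (T x' - x') = ((x' + α⁻¹ • (T x' - x')) - (x + α⁻¹ • (T x - x)))
      + ((α⁻¹ - m) • (T x - x) - m • e) := by
    have : x' = x + m • (T x - x) + m • e := by rw [hx']; module
    rw [sub_smul, add_sub_right_comm]
    nth_rewrite 3 [this]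
    abel
  have h3 : ‖x' - x‖ ≤ m * ‖T x - x‖ + m * ‖e‖ := by
    have : x' - x = m • (T x - x) + m • e := by rw [hx']; module
    rw [this]
    refine (norm_add_le _ _).trans_eq ?_
    simp [norm_smul, abs_of_pos hm.1]
  have h4 : ‖(α⁻¹ - m) • (T x - x) - m • e‖ ≤ (α⁻¹ - m) * ‖T x - x‖ + m * ‖e‖ := by
    refine (norm_sub_le _ _).trans_eq ?_
    have : 0 ≤ α⁻¹ - m := by
      have := hm.2
      rw [one_div] at this
      linarith
    rw [norm_smul, norm_smul, Real.norm_of_nonneg this, Real.norm_of_nonneg hm.1.le]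
  have h5 : α⁻¹ * ‖T x' - x'‖ ≤ α⁻¹ * ‖T x - x‖ + 2 * (m * ‖e‖) := by
    have h6 : ‖α⁻¹ • (T x' - x')‖ = α⁻¹ * ‖T x' - x'‖ := by
      rw [norm_smul, Real.norm_of_nonneg (inv_pos.2 hα).le]
    rw [← h6, h2]
    refine (norm_add_le _ _).trans ?_
    linarith
  have h7 := mul_le_mul_of_nonneg_left h5 hα.le
  rw [mul_add, mul_inv_cancel_left₀ hα.ne', mul_inv_cancel_left₀ hα.ne'] at h7
  linarith

theorem IsAveraged.norm_residual_le (hα : 0 < α) (hT : IsAveraged α T)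
    {z : H} (hz : T z = z) (x : H) : ‖T x - x‖ ≤ 2 * α * ‖x - z‖ := by
  have h := hT.norm_le x z
  rw [hz, sub_self, smul_zero, add_zero] at h
  have h1 : α⁻¹ • (T x - x) = (x + α⁻¹ • (T x - x) - z) - (x - z) := by abel
  have h2 : α⁻¹ * ‖T x - x‖ ≤ 2 * ‖x - z‖ := by
    have h3 : ‖α⁻¹ • (T x - x)‖ = α⁻¹ * ‖T x - x‖ := by
      rw [norm_smul, Real.norm_of_nonneg (inv_pos.2 hα).le]
    rw [← h3, h1]
    exact (norm_sub_le _ _).trans (by linarith)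
  rw [inv_mul_le_iff₀ hα] at h2
  linarith

end Averaged

/-! ### Real sequences with summable perturbations. -/

section Sequences

/-- A nonnegative sequence with summable upward increments converges. -/
theorem exists_tendsto_of_le_add_summable {a r : ℕ → ℝ} (ha : ∀ n, 0 ≤ a n)
    (hr : Summable r) (h : ∀ n, a (n + 1) ≤ a n + r n) :
    ∃ l, Tendsto a atTop (𝓝 l) := by
  set b : ℕ → ℝ := fun n => a n - ∑ k ∈ Finset.range n, r k with hb
  have hr' := hr.hasSum.tendsto_sum_nat
  have hanti : Antitone b := antitone_nat_of_succ_le fun n => by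
    simp only [hb, Finset.sum_range_succ]
    linarith [h n]
  have hbdd : BddBelow (Set.range b) := by
    obtain ⟨M, hM⟩ := hr'.bddAbove_range
    refine ⟨-M, ?_⟩
    rintro _ ⟨n, rfl⟩
    have := hM ⟨n, rfl⟩
    simp only at this
    simp only [hb]
    linarith [ha n]
  refine ⟨_, ((tendsto_atTop_ciInf hanti hbdd).add hr').congr fun n => ?_⟩
  simp [hb]

theorem le_add_sum_of_le_add {a r : ℕ → ℝ} (h : ∀ n, a (n + 1) ≤ a n + r n) (n : ℕ) :
    a n ≤ a 0 + ∑ k ∈ Finset.range n, r k := by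
  induction n with
  | zero => simp
  | succ n ih => rw [Finset.sum_range_succ]; linarith [h n]

/-- If `∑ dₙ = ∞`, `∑ dₙ qₙ² < ∞` and `qₙ → l`, then `l = 0`. -/
theorem eq_zero_of_summable_mul_sq {d q : ℕ → ℝ} {l : ℝ} (hd : ∀ n, 0 ≤ d n)
    (hdiv : Tendsto (fun N => ∑ n ∈ Finset.range N, d n) atTop atTop)
    (hs : Summable fun n => d n * q n ^ 2) (hq : Tendsto q atTop (𝓝 l)) : l = 0 := by
  by_contra hl
  have hl2 : 0 < l ^ 2 := by positivity
  have hev : ∀ᶠ n in atTop, l ^ 2 / 2 < q n ^ 2 := (hq.pow 2).eventually_const_lt (by linarith)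
  have hsum : Summable d := by
    refine Summable.of_norm_bounded_eventually_nat (hs.mul_left (2 / l ^ 2)) ?_
    filter_upwards [hev] with n hn
    rw [Real.norm_of_nonneg (hd n)]
    calc d n = 2 / l ^ 2 * (d n * (l ^ 2 / 2)) := by field_simp
      _ ≤ 2 / l ^ 2 * (d n * q n ^ 2) := by
        gcongr
        exact hd n
  exact not_tendsto_nhds_of_tendsto_atTop hdiv _ hsum.hasSum.tendsto_sum_nat

end Sequences

/-! ### Weak limits, demiclosedness and Opial's lemma. -/

section Weak

variable {H : Type*} [NormedAddCommGroup H] [InnerProductSpace ℝ H]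

/-- Bounded sequences in a Hilbert space converge weakly along ultrafilters. -/
theorem exists_weakLimit_ultrafilter [CompleteSpace H] {u : ℕ → H} {M : ℝ}
    (hu : ∀ n, ‖u n‖ ≤ M) (U : Ultrafilter ℕ) :
    ∃ z : H, ∀ y, Tendsto (fun n => inner ℝ (u n) y) U (𝓝 (inner ℝ z y)) := by
  have hex : ∀ y, ∃ l : ℝ, Tendsto (fun n => inner ℝ (u n) y) U (𝓝 l) ∧ ‖l‖ ≤ M * ‖y‖ := by
    intro y
    have hmem : ∀ n, inner ℝ (u n) y ∈ Metric.closedBall (0 : ℝ) (M * ‖y‖) := fun n => by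
      rw [mem_closedBall_zero_iff]
      exact (norm_inner_le_norm _ _).trans (by gcongr; exact hu n)
    obtain ⟨l, hl, hl'⟩ := (isCompact_closedBall (0 : ℝ) (M * ‖y‖)).ultrafilter_le_nhds
      (U.map fun n => inner ℝ (u n) y) (by
        simp only [Ultrafilter.coe_map, le_principal_iff, mem_map]
        exact Filter.univ_mem' hmem)
    exact ⟨l, hl', mem_closedBall_zero_iff.1 hl⟩
  choose f hf hfb using hex
  let L : H →ₗ[ℝ] ℝ :=
    { toFun := f
      map_add' := fun a b => tendsto_nhds_unique (hf (a + b))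
        (((hf a).add (hf b)).congr fun n => (inner_add_right _ _ _).symm)
      map_smul' := fun c a => tendsto_nhds_unique (hf (c • a))
        (((hf a).const_mul c).congr fun n => (inner_smul_right _ _ _).symm) }
  refine ⟨(InnerProductSpace.toDual ℝ H).symm (L.mkContinuous M hfb), fun y => ?_⟩
  rw [InnerProductSpace.toDual_symm_apply]
  exact hf y

/-- Demiclosedness principle for averaged operators, along an arbitrary filter. -/
theorem IsAveraged.fixed_of_weakLimit {α : ℝ} {T : H → H} (hα : 0 < α) (hT : IsAveraged α T)
    {u : ℕ → H} {M : ℝ} (hu : ∀ n, ‖u n‖ ≤ M) {l : Filter ℕ} [l.NeBot] {z : H}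
    (hz : ∀ y, Tendsto (fun n => inner ℝ (u n) y) l (𝓝 (inner ℝ z y)))
    (hres : Tendsto (fun n => ‖T (u n) - u n‖) l (𝓝 0)) : T z = z := by
  -- Since `w = R z - z`, the vector `u n - z - w` is `u n - R z`, of norm at most `‖u n - z‖` plus
  -- the scaled residual. Squaring isolates `‖w‖²`, and the cross term vanishes weakly.
  set w := α⁻¹ • (T z - z) with hw
  have hbound : ∀ n, ‖w‖ ^ 2 - 2 * inner ℝ (u n - z) w ≤
      α⁻¹ * ‖T (u n) - u n‖ * (α⁻¹ * ‖T (u n) - u n‖ + 2 * (M + ‖z‖)) := by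
    intro n
    have h1 := hT.norm_le (u n) z
    set r := α⁻¹ * ‖T (u n) - u n‖ with hr
    have hr0 : 0 ≤ r := mul_nonneg (inv_pos.2 hα).le (norm_nonneg _)
    have hrn : ‖α⁻¹ • (T (u n) - u n)‖ = r := by
      rw [norm_smul, Real.norm_of_nonneg (inv_pos.2 hα).le]
    have h2 : ‖(u n - z) - w‖ ≤ ‖u n - z‖ + r := by
      have : (u n - z) - w = ((u n + α⁻¹ • (T (u n) - u n)) - (z + α⁻¹ • (T z - z)))
          - α⁻¹ • (T (u n) - u n) := by rw [hw]; abel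
      rw [this]
      refine (norm_sub_le _ _).trans ?_
      rw [hrn]
      linarith
    have h3 := pow_le_pow_left₀ (norm_nonneg _) h2 2
    rw [norm_sub_sq_real] at h3
    have h4 : ‖u n - z‖ ≤ M + ‖z‖ := (norm_sub_le _ _).trans (by linarith [hu n])
    nlinarith
  have hlim1 : Tendsto (fun n => ‖w‖ ^ 2 - 2 * inner ℝ (u n - z) w) l (𝓝 (‖w‖ ^ 2)) := by
    have : Tendsto (fun n => inner ℝ (u n - z) w) l (𝓝 0) := by
      have h := (hz w).sub_const (inner ℝ z w)
      rw [sub_self] at h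
      exact h.congr fun n => (inner_sub_left _ _ _).symm
    simpa using (this.const_mul 2).const_sub (‖w‖ ^ 2)
  have hlim2 : Tendsto (fun n => α⁻¹ * ‖T (u n) - u n‖ *
      (α⁻¹ * ‖T (u n) - u n‖ + 2 * (M + ‖z‖))) l (𝓝 0) := by
    have h := hres.const_mul α⁻¹
    simpa using h.mul (h.add_const (2 * (M + ‖z‖)))
  have h0 : ‖w‖ ^ 2 ≤ 0 := le_of_tendsto_of_tendsto' hlim1 hlim2 hbound
  have hw0 : w = 0 := by
    rw [← norm_eq_zero]
    exact pow_eq_zero_iff two_ne_zero |>.1 (le_antisymm h0 (sq_nonneg _))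
  rw [hw, smul_eq_zero] at hw0
  exact sub_eq_zero.1 (hw0.resolve_left (inv_ne_zero hα.ne'))

/-- Opial's lemma for averaged operators: a sequence with vanishing residual whose distances to all
fixed points converge is weakly convergent to a fixed point. -/
theorem IsAveraged.exists_weakTendsto [CompleteSpace H] {α : ℝ} {T : H → H} (hα : 0 < α)
    (hT : IsAveraged α T) (hFix : (Function.fixedPoints T).Nonempty) {u : ℕ → H}
    (hdist : ∀ z ∈ Function.fixedPoints T, ∃ l, Tendsto (fun n => ‖u n - z‖) atTop (𝓝 l))
    (hres : Tendsto (fun n => ‖T (u n) - u n‖) atTop (𝓝 0)) :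
    ∃ z ∈ Function.fixedPoints T, WeakTendsto u z := by
  obtain ⟨M, hM⟩ : ∃ M, ∀ n, ‖u n‖ ≤ M := by
    obtain ⟨z, hz⟩ := hFix
    obtain ⟨l, hl⟩ := hdist z hz
    obtain ⟨B, hB⟩ := hl.bddAbove_range
    refine ⟨B + ‖z‖, fun n => ?_⟩
    have h1 : ‖u n - z‖ ≤ B := hB ⟨n, rfl⟩
    have h2 := norm_add_le (u n - z) z
    rw [sub_add_cancel] at h2
    linarith
  choose w hw using exists_weakLimit_ultrafilter hM
  have hfix : ∀ U : Ultrafilter ℕ, (U : Filter ℕ) ≤ atTop → w U ∈ Function.fixedPoints T := fun U hU =>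
    hT.fixed_of_weakLimit hα hM (hw U) (hres.mono_left hU)
  have huniq : ∀ U V : Ultrafilter ℕ, (U : Filter ℕ) ≤ atTop →
      (V : Filter ℕ) ≤ atTop → w U = w V := by
    intro U V hU hV
    obtain ⟨l₁, hl₁⟩ := hdist _ (hfix U hU)
    obtain ⟨l₂, hl₂⟩ := hdist _ (hfix V hV)
    -- By polarization this inner product is a combination of the two convergent distances, so it
    -- has one limit along every ultrafilter.
    have hlim : Tendsto (fun n => inner ℝ (u n) (w U - w V)) atTop
        (𝓝 ((l₂ ^ 2 - l₁ ^ 2 + ‖w U‖ ^ 2 - ‖w V‖ ^ 2) / 2)) := by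
      refine (((((hl₂.pow 2).sub (hl₁.pow 2)).add_const (‖w U‖ ^ 2)).sub_const
        (‖w V‖ ^ 2)).div_const 2).congr fun n => ?_
      rw [norm_sub_sq_real, norm_sub_sq_real, inner_sub_right]
      ring
    have h1 := tendsto_nhds_unique (hw U (w U - w V)) (hlim.mono_left hU)
    have h2 := tendsto_nhds_unique (hw V (w U - w V)) (hlim.mono_left hV)
    have h3 : inner ℝ (w U - w V) (w U - w V) = 0 := by
      rw [inner_sub_left, h1, h2, sub_self]
    exact sub_eq_zero.1 (inner_self_eq_zero.1 h3)
  have hU₀ : (Ultrafilter.of (atTop : Filter ℕ) : Filter ℕ) ≤ (atTop : Filter ℕ) := Ultrafilter.of_le _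
  refine ⟨w _, hfix _ hU₀, fun y => (tendsto_iff_ultrafilter _ _ _).2 fun V hV => ?_⟩
  rw [huniq _ V hU₀ hV]
  exact hw V y

/-- Weak lower semicontinuity of the norm; it lets the weak limit inherit the `L²` bound on the
iterates. -/
theorem WeakTendsto.norm_sub_le {u : ℕ → H} {z a : H} {M : ℝ} (h : WeakTendsto u z)
    (hM : ∀ n, ‖u n - a‖ ≤ M) : ‖z - a‖ ≤ M := by
  have hlim : Tendsto (fun n => inner ℝ (u n - a) (z - a)) atTop (𝓝 (‖z - a‖ ^ 2)) := by
    rw [← real_inner_self_eq_norm_sq, inner_sub_left z a]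
    exact ((h (z - a)).sub_const _).congr fun n => (inner_sub_left _ _ _).symm
  have h1 : ‖z - a‖ ^ 2 ≤ M * ‖z - a‖ := le_of_tendsto' hlim fun n =>
    (real_inner_le_norm _ _).trans (by gcongr; exact hM n)
  by_contra hc
  have hM0 : 0 ≤ M := (norm_nonneg _).trans (hM 0)
  nlinarith

end Weak
-- Measurability of weak limits.
section Measurability

variable {Ω H : Type*} [MeasurableSpace Ω] [NormedAddCommGroup H] [InnerProductSpace ℝ H]
  [TopologicalSpace.SeparableSpace H] [MeasurableSpace H] [BorelSpace H]

/-- Scalarly measurable functions into a separable Hilbert space are measurable. -/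
theorem measurable_of_measurable_inner {f : Ω → H}
    (hf : ∀ y, Measurable fun ω => inner ℝ (f ω) y) : Measurable f := by
  have hnorm : ∀ c, Measurable fun ω => ‖f ω - c‖ := by
    intro c
    refine measurable_of_Iic fun r => ?_
    rcases lt_or_ge r 0 with hr | hr
    · convert MeasurableSet.empty
      ext ω
      simpa using hr.trans_le (norm_nonneg _)
    -- By density and duality, a closed ball is a countable intersection of half-spaces, each seen
    -- by a single inner product.
    have : (fun ω => ‖f ω - c‖) ⁻¹' Set.Iic r = ⋂ n : ℕ,
        {ω | inner ℝ (f ω) (TopologicalSpace.denseSeq H n)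
            - inner ℝ c (TopologicalSpace.denseSeq H n)
          ≤ r * ‖TopologicalSpace.denseSeq H n‖} := by
      ext ω
      simp only [Set.mem_preimage, Set.mem_Iic, Set.mem_iInter, Set.mem_ofPred_eq,
        ← inner_sub_left]
      constructor
      · intro h n
        exact (real_inner_le_norm _ _).trans (by gcongr)
      · intro h
        have hall : ∀ y, inner ℝ (f ω - c) y ≤ r * ‖y‖ := by
          have hcl : IsClosed {y | inner ℝ (f ω - c) y ≤ r * ‖y‖} :=
            isClosed_le (by fun_prop) (by fun_prop)
          intro y
          exact (TopologicalSpace.denseRange_denseSeq H).induction_on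
            (p := fun y => inner ℝ (f ω - c) y ≤ r * ‖y‖) y hcl h
        have h1 := hall (f ω - c)
        rw [real_inner_self_eq_norm_sq] at h1
        rcases (norm_nonneg (f ω - c)).eq_or_lt with h0 | h0
        · rwa [← h0]
        · nlinarith
    rw [this]
    exact MeasurableSet.iInter fun n => measurableSet_le ((hf _).sub_const _) measurable_const
  refine measurable_of_isOpen fun U hU => ?_
  have hball : ∀ c ∈ U, ∃ r > 0, Metric.ball c r ⊆ U := fun c hc => Metric.isOpen_iff.1 hU c hc
  choose! r hr hrU using hball
  obtain ⟨S, hSU, hS, hUeq⟩ := TopologicalSpace.countable_cover_nhdsWithin (s := U)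
    (f := fun c => Metric.ball c (r c)) fun c hc =>
      mem_nhdsWithin_of_mem_nhds (Metric.ball_mem_nhds c (hr c hc))
  have : U = ⋃ c ∈ S, Metric.ball c (r c) :=
    hUeq.antisymm (Set.iUnion₂_subset fun c hc => hrU c (hSU hc))
  rw [this, Set.preimage_iUnion₂]
  refine MeasurableSet.biUnion hS fun c _ => ?_
  have : f ⁻¹' Metric.ball c (r c) = {ω | ‖f ω - c‖ < r c} := by
    ext ω
    simp [dist_eq_norm]
  rw [this]
  exact measurableSet_lt (hnorm c) measurable_const

theorem exists_measurable_weakLimit {P : Measure Ω} {x : ℕ → Ω → H}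
    (hx : ∀ n, Measurable (x n)) {F : Set H} (hF : F.Nonempty)
    (h : ∀ᵐ ω ∂P, ∃ z ∈ F, WeakTendsto (fun n => x n ω) z) :
    ∃ xlim : Ω → H, Measurable xlim ∧ (∀ ω, xlim ω ∈ F) ∧ AsWeakTendsto P x xlim := by
  classical
  obtain ⟨z₀, hz₀⟩ := hF
  obtain ⟨G, hGm, hG, hGP⟩ : ∃ G : Set Ω, MeasurableSet G ∧
      (∀ ω ∈ G, ∃ z ∈ F, WeakTendsto (fun n => x n ω) z) ∧ ∀ᵐ ω ∂P, ω ∈ G := by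
    obtain ⟨N, hN, hNm, hN0⟩ := exists_measurable_superset_of_null (ae_iff.1 h)
    refine ⟨Nᶜ, hNm.compl, fun ω hω => ?_, measure_eq_zero_iff_ae_notMem.1 hN0⟩
    by_contra hc
    exact hω (hN hc)
  choose! w hwF hw using hG
  refine ⟨fun ω => if ω ∈ G then w ω else z₀, ?_, fun ω => ?_, ?_⟩
  · refine measurable_of_measurable_inner fun y => ?_
    refine measurable_of_tendsto_metrizable
      (f := fun n ω => if ω ∈ G then inner ℝ (x n ω) y else inner ℝ z₀ y)
      (fun n => Measurable.ite hGm ((hx n).inner measurable_const) measurable_const) ?_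
    refine tendsto_pi_nhds.2 fun ω => ?_
    by_cases hω : ω ∈ G
    · simpa [hω] using hw ω hω y
    · simp [hω]
  · by_cases hω : ω ∈ G
    · simpa [hω] using hwF ω hω
    · simpa [hω] using hz₀
  · filter_upwards [hGP] with ω hω
    simpa [hω] using hw ω hω

end Measurability

/-! ### Summability, independence and domination for integrals. -/

section Integrals

variable {Ω : Type*} [MeasurableSpace Ω] {P : Measure Ω}

/-- The indicators `1_{Cₙ} fₙ` have summable `L¹` norms, hence are almost surely summable, and on `⋂
Cₙ` they equal `fₙ`. -/
theorem ae_summable_of_summable_setIntegral {f : ℕ → Ω → ℝ} {C : ℕ → Set Ω}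
    (hC : ∀ n, MeasurableSet (C n)) (hf0 : ∀ n, 0 ≤ᵐ[P] f n) (hf : ∀ n, Integrable (f n) P)
    (hs : Summable fun n => ∫ ω in C n, f n ω ∂P) :
    ∀ᵐ ω ∂P, (∀ n, ω ∈ C n) → Summable fun n => f n ω := by
  have key : ∀ n, eLpNorm ((C n).indicator (f n)) 1 P = ENNReal.ofReal (∫ ω in C n, f n ω ∂P) := by
    intro n
    rw [eLpNorm_indicator_eq_eLpNorm_restrict (hC n), eLpNorm_one_eq_lintegral_enorm,
      ofReal_integral_eq_lintegral_ofReal (hf n).restrict (ae_restrict_of_ae (hf0 n))]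
    refine lintegral_congr_ae ?_
    filter_upwards [ae_restrict_of_ae (hf0 n)] with ω hω
    rw [Real.enorm_eq_ofReal hω]
  have h := summable_norm_of_tsum_eLpNorm_ne_top (μ := P) le_rfl
    (f := fun n => (C n).indicator (f n)) (fun n => ((hf n).indicator (hC n)).aestronglyMeasurable)
    (by simp_rw [key]; exact hs.tsum_ofReal_ne_top)
  filter_upwards [h] with ω hω hωC
  refine Summable.of_norm ?_
  simpa [Set.indicator_of_mem (hωC _)] using hω

/-- `C` and `g` both belong to `m`, so `1_C g` is independent of `φ(X)`. Keeping the event `C` is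
what makes localization compatible with independence. -/
theorem setIntegral_comp_mul_of_indep {Ω : Type*} {m m0 : MeasurableSpace Ω} {P : Measure Ω}
    {X : Ω → ℝ} (hm : m ≤ m0) (hX : Measurable X)
    (hind : Indep (MeasurableSpace.comap X inferInstance) m P) {φ : ℝ → ℝ} (hφ : Measurable φ)
    {g : Ω → ℝ} (hg : Measurable[m] g) {C : Set Ω} (hC : MeasurableSet[m] C) :
    ∫ ω in C, φ (X ω) * g ω ∂P = (∫ ω, φ (X ω) ∂P) * ∫ ω in C, g ω ∂P := by
  have hi : IndepFun (fun ω => φ (X ω)) (C.indicator g) P := by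
    rw [IndepFun_iff_Indep]
    refine indep_of_indep_of_le hind ?_ (Measurable.comap_le (hg.indicator hC))
    exact Measurable.comap_le (hφ.comp (comap_measurable X))
  have h := hi.integral_mul_eq_mul_integral (hφ.comp hX).aestronglyMeasurable
    ((hg.indicator hC).mono hm le_rfl).aestronglyMeasurable
  rw [← integral_indicator (hm _ hC), ← integral_indicator (hm _ hC), ← h]
  refine integral_congr_ae (.of_forall fun ω => ?_)
  by_cases hω : ω ∈ C <;> simp [hω]

/-- Conditional Jensen inequality for the square, in square root form. -/
theorem condExp_le_sqrt_condExp_sq {Ω : Type*} {m m0 : MeasurableSpace Ω} {P : Measure Ω}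
    [IsFiniteMeasure P] (hm : m ≤ m0) {f : Ω → ℝ} (hf : MemLp f 2 P) :
    ∀ᵐ ω ∂P, (P[f | m]) ω ≤ √((P[fun ω => f ω ^ 2 | m]) ω) := by
  have h := ConvexOn.map_condExp_le_univ (μ := P) (m := m) hm (φ := fun t : ℝ => t ^ 2)
    even_two.convexOn_pow (by fun_prop : Continuous fun t : ℝ => t ^ 2).lowerSemicontinuous
    (hf.integrable one_le_two) hf.integrable_sq
  filter_upwards [h] with ω hω
  exact Real.le_sqrt_of_sq_le hω

theorem tendsto_eLpNorm_sub_of_dominated [IsFiniteMeasure P] {E : Type*} [NormedAddCommGroup E]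
    {p : ℝ≥0∞} (hp : 1 ≤ p) (hp' : p ≠ ∞) {f : ℕ → Ω → E} {g : Ω → E} {D : Ω → ℝ}
    (hf : ∀ n, AEStronglyMeasurable (f n) P) (hg : MemLp g p P) (hD : MemLp D p P)
    (hfD : ∀ n, ∀ᵐ ω ∂P, ‖f n ω‖ ≤ D ω) (hfg : ∀ᵐ ω ∂P, Tendsto (fun n => f n ω) atTop (𝓝 (g ω))) :
    Tendsto (fun n => eLpNorm (f n - g) p P) atTop (𝓝 0) := by
  refine tendsto_Lp_finite_of_tendsto_ae hp hp' hf hg ?_ hfg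
  intro ε hε
  obtain ⟨δ, hδ, h⟩ := unifIntegrable_const (ι := ℕ) hp hp' hD hε
  refine ⟨δ, hδ, fun n s hs hsδ => le_trans (eLpNorm_mono_ae ?_) (h n s hs hsδ)⟩
  filter_upwards [hfD n] with ω hω
  by_cases hωs : ω ∈ s
  · simpa [hωs] using hω.trans (le_abs_self _)
  · simp [hωs]

/-- Minkowski's inequality bounds the partial sums; Fatou's lemma passes the bound to the limit. -/
theorem memLp_tsum_norm {E : Type*} [NormedAddCommGroup E] {p : ℝ≥0∞} (hp : 1 ≤ p)
    {f : ℕ → Ω → E} (hf : ∀ n, AEStronglyMeasurable (f n) P)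
    (hs : ∑' n, eLpNorm (f n) p P ≠ ∞) : MemLp (fun ω => ∑' n, ‖f n ω‖) p P := by
  have hsum := summable_norm_of_tsum_eLpNorm_ne_top hp hf hs
  have hlim : ∀ᵐ ω ∂P, Tendsto (fun N => ∑ n ∈ Finset.range N, ‖f n ω‖) atTop
      (𝓝 (∑' n, ‖f n ω‖)) := by
    filter_upwards [hsum] with ω hω
    exact hω.hasSum.tendsto_sum_nat
  have hmeas : ∀ N, AEStronglyMeasurable (fun ω => ∑ n ∈ Finset.range N, ‖f n ω‖) P := fun N =>
    Finset.aestronglyMeasurable_fun_sum _ fun n _ => (hf n).norm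
  refine ⟨aestronglyMeasurable_of_tendsto_ae atTop hmeas hlim, ?_⟩
  refine lt_of_le_of_lt (Lp.eLpNorm_lim_le_liminf_eLpNorm hmeas _ hlim) ?_
  refine lt_of_le_of_lt ?_ hs.lt_top
  refine liminf_le_of_le (by isBoundedDefault) fun b hb => ?_
  obtain ⟨N, hN⟩ := hb.exists
  refine hN.trans (le_trans ?_ (ENNReal.sum_le_tsum (Finset.range N)))
  have := eLpNorm_sum_le (μ := P) (p := p) (s := Finset.range N) (f := fun n ω => ‖f n ω‖)
    (fun n _ => (hf n).norm) hp
  simp only [eLpNorm_norm] at this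
  refine le_trans (le_of_eq ?_) this
  congr 1
  ext ω
  simp

end Integrals

/-! ### The history filtration. -/

section Sigma

variable {Ω H : Type*} [MeasurableSpace H]

theorem comap_le_sigmaUpTo (x : ℕ → Ω → H) {j n : ℕ} (h : j ≤ n) :
    MeasurableSpace.comap (x j) inferInstance ≤ sigmaUpTo x n :=
  le_iSup₂_of_le j (Finset.mem_range.2 (by omega)) le_rfl

theorem sigmaUpTo_mono (x : ℕ → Ω → H) : Monotone (sigmaUpTo x) := fun _ _ h =>
  iSup₂_le fun _ hj => comap_le_sigmaUpTo x (by have := Finset.mem_range.1 hj; omega)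

theorem measurable_sigmaUpTo (x : ℕ → Ω → H) {j n : ℕ} (h : j ≤ n) :
    Measurable[sigmaUpTo x n] (x j) :=
  (comap_measurable (x j)).mono (comap_le_sigmaUpTo x h) le_rfl

theorem sigmaUpTo_le [MeasurableSpace Ω] {x : ℕ → Ω → H} (hx : ∀ n, Measurable (x n)) (n : ℕ) :
    sigmaUpTo x n ≤ ‹MeasurableSpace Ω› :=
  iSup₂_le fun j _ => (hx j).comap_le

end Sigma

/-! ### The noisy iteration and its localized energy estimate. -/

section Iteration

variable {Ω H : Type*} [MeasurableSpace Ω] [NormedAddCommGroup H] [InnerProductSpace ℝ H]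
  [MeasurableSpace H]

/-- The stochastic Krasnosel'skii–Mann iteration with random relaxations `μ` and errors `e`. -/
structure IsNoisyKM (P : Measure Ω) (α : ℝ) (T : H → H) (x e : ℕ → Ω → H) (μ : ℕ → Ω → ℝ) :
    Prop where
  pos : 0 < α
  averaged : IsAveraged α T
  measurable_x : ∀ n, Measurable (x n)
  memLp_zero : MemLp (x 0) 2 P
  measurable_e : ∀ n, Measurable (e n)
  memLp_e : ∀ n, MemLp (e n) 2 P
  measurable_relax : ∀ n, Measurable (μ n)
  mem_Ioo : ∀ n, ∀ᵐ ω ∂P, μ n ω ∈ Set.Ioo (0 : ℝ) (1 / α)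
  step : ∀ n, ∀ᵐ ω ∂P, x (n + 1) ω = x n ω + μ n ω • (T (x n ω) + e n ω - x n ω)
  indep : ∀ n, Indep (MeasurableSpace.comap (μ n) inferInstance)
    (MeasurableSpace.comap (e n) inferInstance ⊔ sigmaUpTo x n) P

namespace IsNoisyKM

variable {P : Measure Ω} {α : ℝ} {T : H → H} {x e : ℕ → Ω → H} {μ : ℕ → Ω → ℝ} {z : H}

theorem weight_nonneg (h : IsNoisyKM P α T x e μ) (n : ℕ) :
    ∀ᵐ ω ∂P, 0 ≤ μ n ω * (1 - α * μ n ω) := by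
  filter_upwards [h.mem_Ioo n] with ω hω
  have := (lt_div_iff₀ h.pos).1 hω.2
  exact mul_nonneg hω.1.le (by linarith)

theorem integral_weight_nonneg (h : IsNoisyKM P α T x e μ) (n : ℕ) :
    0 ≤ ∫ ω, μ n ω * (1 - α * μ n ω) ∂P :=
  integral_nonneg_of_ae (h.weight_nonneg n)

/-- The null set does not depend on `z`, so Opial's lemma can use all fixed points along one path.
-/
theorem norm_sub_succ_le (h : IsNoisyKM P α T x e μ) (n : ℕ) :
    ∀ᵐ ω ∂P, ∀ z, T z = z → ‖x (n + 1) ω - z‖ ≤ ‖x n ω - z‖ + μ n ω * ‖e n ω‖ := by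
  filter_upwards [h.mem_Ioo n, h.step n] with ω hμ hx z hz
  rw [hx]
  exact h.averaged.norm_step_le h.pos hz _ _ hμ

theorem norm_residual_succ_le (h : IsNoisyKM P α T x e μ) (n : ℕ) :
    ∀ᵐ ω ∂P, ‖T (x (n + 1) ω) - x (n + 1) ω‖ ≤
      ‖T (x n ω) - x n ω‖ + 2 * α * (μ n ω * ‖e n ω‖) := by
  filter_upwards [h.mem_Ioo n, h.step n] with ω hμ hx
  rw [hx]
  exact h.averaged.norm_residual_step_le h.pos _ _ hμ

theorem sigma_le (h : IsNoisyKM P α T x e μ) (n : ℕ) :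
    MeasurableSpace.comap (e n) inferInstance ⊔ sigmaUpTo x n ≤ ‹MeasurableSpace Ω› :=
  sup_le (h.measurable_e n).comap_le (sigmaUpTo_le h.measurable_x n)

theorem error_nonneg (h : IsNoisyKM P α T x e μ) (n : ℕ) :
    0 ≤ᵐ[P] fun ω => μ n ω * ‖e n ω‖ := by
  filter_upwards [h.mem_Ioo n] with ω hω
  exact mul_nonneg hω.1.le (norm_nonneg _)

theorem integral_relax_nonneg (h : IsNoisyKM P α T x e μ) (n : ℕ) : 0 ≤ ∫ ω, μ n ω ∂P :=
  integral_nonneg_of_ae <| by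
    filter_upwards [h.mem_Ioo n] with ω hω using hω.1.le

/-- Lets the conditional assumption, which involves only `E μₙ`, control the squared errors too. -/
theorem integral_relax_sq_le [IsProbabilityMeasure P] (h : IsNoisyKM P α T x e μ) (n : ℕ) :
    ∫ ω, μ n ω ^ 2 ∂P ≤ 1 / α * ∫ ω, μ n ω ∂P := by
  have hi : ∀ p, MemLp (μ n) p P := fun p => by
    refine MemLp.of_bound (h.measurable_relax n).aestronglyMeasurable (1 / α) ?_
    filter_upwards [h.mem_Ioo n] with ω hω
    rw [Real.norm_of_nonneg hω.1.le]
    exact hω.2.le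
  rw [← integral_const_mul]
  refine integral_mono_ae (hi 2).integrable_sq (((hi 1).integrable le_rfl).const_mul _) ?_
  filter_upwards [h.mem_Ioo n] with ω hω
  simp only [sq]
  exact mul_le_mul_of_nonneg_right hω.2.le hω.1.le

variable [BorelSpace H]

theorem memLp_error (h : IsNoisyKM P α T x e μ) (n : ℕ) :
    MemLp (fun ω => μ n ω * ‖e n ω‖) 2 P := by
  refine MemLp.mono' ((h.memLp_e n).norm.const_mul (1 / α))
    ((h.measurable_relax n).mul (h.measurable_e n).norm).aestronglyMeasurable ?_
  filter_upwards [h.mem_Ioo n] with ω hω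
  rw [norm_mul, norm_norm, Real.norm_of_nonneg hω.1.le]
  gcongr
  exact hω.2.le

theorem setIntegral_weight_mul_residual (h : IsNoisyKM P α T x e μ) (n : ℕ) {C : Set Ω}
    (hC : MeasurableSet[sigmaUpTo x n] C) :
    ∫ ω in C, μ n ω * (1 - α * μ n ω) * ‖T (x n ω) - x n ω‖ ^ 2 ∂P =
      (∫ ω, μ n ω * (1 - α * μ n ω) ∂P) * ∫ ω in C, ‖T (x n ω) - x n ω‖ ^ 2 ∂P := by
  have hx : Measurable[sigmaUpTo x n] (x n) := measurable_sigmaUpTo x le_rfl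
  have hg : Measurable[sigmaUpTo x n] fun ω => ‖T (x n ω) - x n ω‖ ^ 2 := by
    have hc : Measurable fun y : H => ‖T y - y‖ ^ 2 := by
      have := h.averaged.continuous h.pos
      exact Continuous.measurable (by fun_prop)
    exact hc.comp hx
  exact setIntegral_comp_mul_of_indep (sigmaUpTo_le h.measurable_x n) (h.measurable_relax n)
    (indep_of_indep_of_le_right (h.indep n) le_sup_right)
    (φ := fun t => t * (1 - α * t)) (by fun_prop) hg hC

theorem setIntegral_relax_mul_error (h : IsNoisyKM P α T x e μ) (n : ℕ) {C : Set Ω}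
    (hC : MeasurableSet[sigmaUpTo x n] C) :
    ∫ ω in C, μ n ω * ‖e n ω‖ ∂P = (∫ ω, μ n ω ∂P) * ∫ ω in C, ‖e n ω‖ ∂P :=
  setIntegral_comp_mul_of_indep (h.sigma_le n) (h.measurable_relax n) (h.indep n)
    (φ := fun t => t) measurable_id
    (measurable_norm.comp ((comap_measurable (e n)).mono le_sup_left le_rfl))
    ((le_sup_right : sigmaUpTo x n ≤ _) _ hC)

theorem setIntegral_relax_sq_mul_error_sq (h : IsNoisyKM P α T x e μ) (n : ℕ) {C : Set Ω}
    (hC : MeasurableSet[sigmaUpTo x n] C) :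
    ∫ ω in C, (μ n ω * ‖e n ω‖) ^ 2 ∂P =
      (∫ ω, μ n ω ^ 2 ∂P) * ∫ ω in C, ‖e n ω‖ ^ 2 ∂P := by
  simp_rw [mul_pow]
  exact setIntegral_comp_mul_of_indep (h.sigma_le n) (h.measurable_relax n) (h.indep n)
    (φ := fun t => t ^ 2) (by fun_prop)
    ((measurable_norm.pow_const 2).comp ((comap_measurable (e n)).mono le_sup_left le_rfl))
    ((le_sup_right : sigmaUpTo x n ≤ _) _ hC)

/-- By independence, the summability condition in expectation says exactly that the `L²` norms of
`μₙ‖eₙ‖` are summable. -/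
theorem eLpNorm_error (h : IsNoisyKM P α T x e μ) (n : ℕ) :
    eLpNorm (fun ω => μ n ω * ‖e n ω‖) 2 P =
      ENNReal.ofReal √((∫ ω, μ n ω ^ 2 ∂P) * (∫ ω, ‖e n ω‖ ^ 2 ∂P)) := by
  have h1 := h.setIntegral_relax_sq_mul_error_sq n (C := Set.univ) MeasurableSet.univ
  rw [Measure.restrict_univ] at h1
  rw [(h.memLp_error n).eLpNorm_eq_integral_rpow_norm two_ne_zero ENNReal.ofNat_ne_top, ← h1,
    Real.sqrt_eq_rpow]
  simp [mul_pow]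

variable [SecondCountableTopology H]

theorem measurable_residual (h : IsNoisyKM P α T x e μ) (n : ℕ) :
    Measurable fun ω => T (x n ω) - x n ω :=
  ((h.averaged.continuous h.pos).measurable.comp (h.measurable_x n)).sub (h.measurable_x n)

variable [IsProbabilityMeasure P]

theorem memLp_sub (h : IsNoisyKM P α T x e μ) (hz : T z = z) (n : ℕ) :
    MemLp (fun ω => x n ω - z) 2 P := by
  induction n with
  | zero => exact h.memLp_zero.sub (memLp_const z)
  | succ n ih =>
    refine MemLp.mono' (ih.norm.add (h.memLp_error n))
      ((h.measurable_x _).sub_const z).aestronglyMeasurable ?_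
    filter_upwards [h.norm_sub_succ_le n] with ω hω using hω z hz

theorem memLp (h : IsNoisyKM P α T x e μ) (hz : T z = z) (n : ℕ) : MemLp (x n) 2 P := by
  simpa [Pi.add_def] using (h.memLp_sub hz n).add (memLp_const z)

theorem memLp_residual (h : IsNoisyKM P α T x e μ) (hz : T z = z) (n : ℕ) :
    MemLp (fun ω => T (x n ω) - x n ω) 2 P :=
  MemLp.mono' ((h.memLp_sub hz n).norm.const_mul (2 * α))
    (h.measurable_residual n).aestronglyMeasurable
    (.of_forall fun _ => h.averaged.norm_residual_le h.pos hz _)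

theorem integrable_weighted_residual (h : IsNoisyKM P α T x e μ) (hz : T z = z) (n : ℕ) :
    Integrable (fun ω => μ n ω * (1 - α * μ n ω) * ‖T (x n ω) - x n ω‖ ^ 2) P := by
  refine Integrable.mono' ((h.memLp_residual hz n).norm.integrable_sq.const_mul (1 / α)) ?_ ?_
  · have h1 := h.measurable_relax n
    have h2 := h.measurable_residual n
    exact Measurable.aestronglyMeasurable (by fun_prop)
  · filter_upwards [h.weight_nonneg n, h.mem_Ioo n] with ω h1 h2
    rw [norm_mul, Real.norm_of_nonneg h1, norm_pow, norm_norm]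
    gcongr
    have : α * μ n ω * μ n ω ≥ 0 := mul_nonneg (mul_nonneg h.pos.le h2.1.le) h2.1.le
    linarith [h2.2]

/-- If the perturbation terms have summable expectations over a decreasing sequence of events
adapted to the history, then the residuals, weighted by the mean relaxations, are almost surely
square summable on the intersection of these events. -/
theorem ae_summable_weight_mul_residual (h : IsNoisyKM P α T x e μ) (hz : T z = z)
    {C : ℕ → Set Ω} (hC : ∀ n, MeasurableSet[sigmaUpTo x n] (C n)) (hanti : Antitone C)
    (hs : Summable fun n => ∫ ω in C n,
      (2 * (‖x n ω - z‖ * (μ n ω * ‖e n ω‖)) + (μ n ω * ‖e n ω‖) ^ 2) ∂P) :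
    ∀ᵐ ω ∂P, (∀ n, ω ∈ C n) → Summable fun n =>
      (∫ ω', μ n ω' * (1 - α * μ n ω') ∂P) * ‖T (x n ω) - x n ω‖ ^ 2 := by
  have hCm : ∀ n, MeasurableSet (C n) := fun n => sigmaUpTo_le h.measurable_x n _ (hC n)
  have hisq : ∀ n, Integrable (fun ω => ‖x n ω - z‖ ^ 2) P := fun n =>
    (h.memLp_sub hz n).norm.integrable_sq
  have hierr : ∀ n, Integrable (fun ω => 2 * (‖x n ω - z‖ * (μ n ω * ‖e n ω‖))
      + (μ n ω * ‖e n ω‖) ^ 2) P := fun n =>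
    (((h.memLp_sub hz n).norm.integrable_mul (h.memLp_error n)).const_mul 2).add
      (h.memLp_error n).integrable_sq
  set s : ℕ → ℝ := fun n => ∫ ω in C n,
      (2 * (‖x n ω - z‖ * (μ n ω * ‖e n ω‖)) + (μ n ω * ‖e n ω‖) ^ 2) ∂P with hsdef
  set a : ℕ → ℝ := fun n => ∫ ω in C n, ‖x n ω - z‖ ^ 2 ∂P with ha
  set w : ℕ → ℝ := fun n => α⁻¹ * ∫ ω in C n,
    μ n ω * (1 - α * μ n ω) * ‖T (x n ω) - x n ω‖ ^ 2 ∂P with hw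
  have hα := inv_pos.2 h.pos
  have hw0 : ∀ n, 0 ≤ w n := fun n => mul_nonneg hα.le <| integral_nonneg_of_ae <| by
    filter_upwards [ae_restrict_of_ae (h.weight_nonneg n)] with ω hω
    exact mul_nonneg hω (sq_nonneg _)
  have hrec : ∀ n, a (n + 1) + w n ≤ a n + s n := by
    intro n
    -- Shrinking the event only lowers the integral, so the energy recursion survives localization.
    have h1 : a (n + 1) ≤ ∫ ω in C n, ‖x (n + 1) ω - z‖ ^ 2 ∂P :=
      setIntegral_mono_set (hisq _).integrableOn (.of_forall fun _ => sq_nonneg _)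
        (hanti n.le_succ).eventuallyLE
    have hiw := (h.integrable_weighted_residual hz n).const_mul α⁻¹
    have h2 : (∫ ω in C n, ‖x (n + 1) ω - z‖ ^ 2 ∂P) + w n = ∫ ω in C n, (‖x (n + 1) ω - z‖ ^ 2
        + α⁻¹ * (μ n ω * (1 - α * μ n ω) * ‖T (x n ω) - x n ω‖ ^ 2)) ∂P := by
      rw [integral_add (hisq _).integrableOn hiw.integrableOn, integral_const_mul]
    have h3 : a n + s n = ∫ ω in C n, (‖x n ω - z‖ ^ 2 +
        (2 * (‖x n ω - z‖ * (μ n ω * ‖e n ω‖)) + (μ n ω * ‖e n ω‖) ^ 2)) ∂P := by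
      rw [integral_add (hisq _).integrableOn (hierr _).integrableOn]
    have h4 : (∫ ω in C n, ‖x (n + 1) ω - z‖ ^ 2 ∂P) + w n ≤ a n + s n := by
      rw [h2, h3]
      refine setIntegral_mono_ae ((hisq _).add hiw).integrableOn
        ((hisq _).add (hierr _)).integrableOn ?_
      filter_upwards [h.mem_Ioo n, h.step n] with ω hμ hx
      have := h.averaged.norm_sq_step_le h.pos hz (x n ω) (e n ω) hμ
      rw [← hx] at this
      linarith
    linarith
  have hs0 : ∀ n, 0 ≤ s n := fun n => integral_nonneg_of_ae <| by
    filter_upwards [ae_restrict_of_ae (h.error_nonneg n)] with ω hω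
    have : 0 ≤ ‖x n ω - z‖ * (μ n ω * ‖e n ω‖) := mul_nonneg (norm_nonneg _) hω
    simp only [Pi.zero_apply]
    positivity
  have hsum : ∀ n, a n + ∑ k ∈ Finset.range n, w k ≤ a 0 + ∑ k ∈ Finset.range n, s k := by
    intro n
    induction n with
    | zero => simp
    | succ n ih =>
      rw [Finset.sum_range_succ, Finset.sum_range_succ]
      linarith [hrec n]
  have hwsum : Summable w := by
    refine summable_of_sum_range_le (c := a 0 + ∑' k, s k) hw0 fun n => ?_
    have h1 : 0 ≤ a n := integral_nonneg fun _ => sq_nonneg _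
    have h2 := hs.sum_le_tsum (Finset.range n) fun k _ => hs0 k
    linarith [hsum n]
  refine ae_summable_of_summable_setIntegral hCm
    (fun n => .of_forall fun ω => mul_nonneg (h.integral_weight_nonneg n) (sq_nonneg _))
    (fun n => (h.memLp_residual hz n).norm.integrable_sq.const_mul _) ?_
  refine (hwsum.mul_left α).congr fun n => ?_
  rw [integral_const_mul, ← h.setIntegral_weight_mul_residual n (hC n)]
  exact mul_inv_cancel_left₀ h.pos.ne' _

/-- Almost sure summability of the errors and vanishing of the residuals, from a localization of
the errors. -/
theorem ae_summable_error_and_tendsto_residual (h : IsNoisyKM P α T x e μ) (hz : T z = z)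
    (hdiv : Tendsto (fun N => ∑ n ∈ Finset.range N, ∫ ω, μ n ω * (1 - α * μ n ω) ∂P) atTop atTop)
    {C : ℕ → ℕ → Set Ω} (hC : ∀ K n, MeasurableSet[sigmaUpTo x n] (C K n))
    (hanti : ∀ K, Antitone (C K)) (hcover : ∀ᵐ ω ∂P, ∃ K, ∀ n, ω ∈ C K n)
    (hs1 : ∀ K, Summable fun n => ∫ ω in C K n, μ n ω * ‖e n ω‖ ∂P)
    (hs2 : ∀ K, Summable fun n => ∫ ω in C K n, (μ n ω * ‖e n ω‖) ^ 2 ∂P) :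
    ∀ᵐ ω ∂P, (Summable fun n => μ n ω * ‖e n ω‖) ∧
      Tendsto (fun n => ‖T (x n ω) - x n ω‖) atTop (𝓝 0) := by
  have hCm : ∀ K n, MeasurableSet (C K n) := fun K n => sigmaUpTo_le h.measurable_x n _ (hC K n)
  have hie : ∀ n, Integrable (fun ω => μ n ω * ‖e n ω‖) P := fun n =>
    (h.memLp_error n).integrable one_le_two
  have hsum : ∀ᵐ ω ∂P, Summable fun n => μ n ω * ‖e n ω‖ := by
    filter_upwards [hcover, ae_all_iff.2 fun K =>
      ae_summable_of_summable_setIntegral (hCm K) h.error_nonneg hie (hs1 K)] with ω ⟨K, hK⟩ hω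
    exact hω K hK
  -- A second localization bounds `‖x n - z‖` by `J` in the cross term of the energy inequality.
  -- Error summability, already proved, makes the distances converge, so almost every path fits some
  -- `J`.
  set A : ℕ → ℕ → Set Ω := fun J n => ⋂ k ∈ Finset.range (n + 1), {ω | ‖x k ω - z‖ ≤ J} with hA
  have hAmem : ∀ J n ω, ω ∈ A J n ↔ ∀ k ≤ n, ‖x k ω - z‖ ≤ J := fun J n ω => by
    simp [hA]
  have hAm : ∀ J n, MeasurableSet[sigmaUpTo x n] (A J n) := fun J n =>
    Finset.measurableSet_biInter _ fun k hk => by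
      have hxk : Measurable[sigmaUpTo x n] (x k) :=
        measurable_sigmaUpTo x (Nat.lt_succ_iff.1 (Finset.mem_range.1 hk))
      exact (measurable_norm.comp ((measurable_id.sub_const z).comp hxk)) measurableSet_Iic
  have hAanti : ∀ J, Antitone (A J) := fun J m n hmn ω hω =>
    (hAmem _ _ _).2 fun k hk => (hAmem _ _ _).1 hω k (hk.trans hmn)
  have hsq : ∀ᵐ ω ∂P, ∀ K J, (∀ n, ω ∈ A J n ∩ C K n) → Summable fun n =>
      (∫ ω', μ n ω' * (1 - α * μ n ω') ∂P) * ‖T (x n ω) - x n ω‖ ^ 2 := by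
    refine ae_all_iff.2 fun K => ae_all_iff.2 fun J => ?_
    refine h.ae_summable_weight_mul_residual hz (fun n => (hAm J n).inter (hC K n))
      (fun m n hmn => Set.inter_subset_inter (hAanti J hmn) (hanti K hmn)) ?_
    have hS := ((hs1 K).mul_left (2 * (J : ℝ))).add (hs2 K)
    have hACm : ∀ n, MeasurableSet (A J n ∩ C K n) := fun n =>
      (sigmaUpTo_le h.measurable_x n _ (hAm J n)).inter (hCm K n)
    refine Summable.of_nonneg_of_le (fun n => integral_nonneg_of_ae ?_) (fun n => ?_) hS
    · filter_upwards [ae_restrict_of_ae (h.error_nonneg n)] with ω hω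
      have : 0 ≤ ‖x n ω - z‖ * (μ n ω * ‖e n ω‖) := mul_nonneg (norm_nonneg _) hω
      simp only [Pi.zero_apply]
      positivity
    · have hi1 := (hie n).const_mul (2 * (J : ℝ))
      have hi2 := (h.memLp_error n).integrable_sq
      rw [← integral_const_mul, ← integral_add hi1.integrableOn hi2.integrableOn]
      refine le_trans (setIntegral_mono_on_ae ?_ (hi1.add hi2).integrableOn (hACm n) ?_)
        (setIntegral_mono_set (hi1.add hi2).integrableOn ?_
          (Set.inter_subset_right (s := A J n)).eventuallyLE)
      · exact ((((h.memLp_sub hz n).norm.integrable_mul (h.memLp_error n)).const_mul 2).add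
          hi2).integrableOn
      · filter_upwards [h.error_nonneg n] with ω hω hωA
        have h1 : ‖x n ω - z‖ ≤ J := (hAmem _ _ _).1 hωA.1 n le_rfl
        have h2 := mul_le_mul_of_nonneg_right h1 hω
        simp only [Pi.add_apply]
        linarith
      · filter_upwards [ae_restrict_of_ae (h.error_nonneg n)] with ω hω
        have h2 : 0 ≤ 2 * (J : ℝ) * (μ n ω * ‖e n ω‖) := mul_nonneg (by positivity) hω
        exact add_nonneg h2 (sq_nonneg _)
  filter_upwards [hcover, hsum, hsq, ae_all_iff.2 h.norm_sub_succ_le,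
    ae_all_iff.2 h.norm_residual_succ_le] with ω ⟨K, hK⟩ hω hωsq hdist hres
  refine ⟨hω, ?_⟩
  obtain ⟨l, hl⟩ := exists_tendsto_of_le_add_summable
    (fun n => norm_nonneg (T (x n ω) - x n ω)) (hω.mul_left (2 * α)) hres
  obtain ⟨d, hd⟩ := exists_tendsto_of_le_add_summable (fun n => norm_nonneg (x n ω - z))
    hω (fun n => hdist n z hz)
  obtain ⟨B, hB⟩ := hd.bddAbove_range
  obtain ⟨J, hJ⟩ := exists_nat_ge B
  have hS := hωsq K J fun n => ⟨(hAmem _ _ _).2 fun k _ => le_trans (hB ⟨k, rfl⟩) hJ, hK n⟩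
  rwa [eq_zero_of_summable_mul_sq h.integral_weight_nonneg hdiv hS hl] at hl

end IsNoisyKM

end Iteration
-- Consequences of the two error conditions.
namespace IsNoisyKM

variable {Ω H : Type*} [MeasurableSpace Ω] [NormedAddCommGroup H] [InnerProductSpace ℝ H]
  [MeasurableSpace H] [BorelSpace H] [SecondCountableTopology H]
  {P : Measure Ω} {α : ℝ} {T : H → H} {x e : ℕ → Ω → H}
  {μ : ℕ → Ω → ℝ} {z : H}

theorem exists_asWeakTendsto [CompleteSpace H] (h : IsNoisyKM P α T x e μ)
    (hFix : (Function.fixedPoints T).Nonempty)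
    (has : ∀ᵐ ω ∂P, (Summable fun n => μ n ω * ‖e n ω‖) ∧
      Tendsto (fun n => ‖T (x n ω) - x n ω‖) atTop (𝓝 0)) :
    ∃ xlim : Ω → H, Measurable xlim ∧ (∀ ω, xlim ω ∈ Function.fixedPoints T) ∧
      AsWeakTendsto P x xlim := by
  refine exists_measurable_weakLimit h.measurable_x hFix ?_
  filter_upwards [has, ae_all_iff.2 h.norm_sub_succ_le] with ω ⟨hs, hres⟩ hdist
  exact h.averaged.exists_weakTendsto h.pos hFix (fun z hz => exists_tendsto_of_le_add_summable
    (fun n => norm_nonneg (x n ω - z)) hs fun n => hdist n z hz) hres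

variable [IsProbabilityMeasure P]

/-- The almost sure conclusions under the conditional error conditions. -/
theorem ae_of_condExp_error (h : IsNoisyKM P α T x e μ) (hz : T z = z)
    (hdiv : Tendsto (fun N => ∑ n ∈ Finset.range N, ∫ ω, μ n ω * (1 - α * μ n ω) ∂P) atTop atTop)
    (h0 : ∀ᵐ ω ∂P, Tendsto
      (fun n => (P[fun ω' => ‖e n ω'‖ ^ 2 | sigmaUpTo x n]) ω) atTop (𝓝 0))
    (hs : ∀ᵐ ω ∂P, Summable (fun n => (∫ ω', μ n ω' ∂P) *
      √((P[fun ω' => ‖e n ω'‖ ^ 2 | sigmaUpTo x n]) ω))) :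
    ∀ᵐ ω ∂P, (Summable fun n => μ n ω * ‖e n ω‖) ∧
      Tendsto (fun n => ‖T (x n ω) - x n ω‖) atTop (𝓝 0) := by
  set v : ℕ → Ω → ℝ := fun n => P[fun ω' => ‖e n ω'‖ ^ 2 | sigmaUpTo x n] with hv
  set c : ℕ → ℝ := fun n => ∫ ω', μ n ω' ∂P with hc
  have hc0 : ∀ n, 0 ≤ c n := h.integral_relax_nonneg
  have hle : ∀ n, sigmaUpTo x n ≤ ‹MeasurableSpace Ω› := sigmaUpTo_le h.measurable_x
  have hvm : ∀ n, Measurable[sigmaUpTo x n] (v n) := fun n =>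
    stronglyMeasurable_condExp.measurable
  have hvi : ∀ n, Integrable (v n) P := fun n => integrable_condExp
  have hεi : ∀ n, Integrable (fun ω => √(v n ω)) P := fun n => by
    refine Integrable.mono' ((integrable_const (1 : ℝ)).add (hvi n).norm)
      (((hvm n).mono (hle n) le_rfl).sqrt).aestronglyMeasurable (.of_forall fun ω => ?_)
    rw [Real.norm_of_nonneg (Real.sqrt_nonneg _)]
    refine Real.sqrt_le_iff.2 ⟨add_nonneg zero_le_one (norm_nonneg _), ?_⟩
    have h1 := le_abs_self (v n ω)
    have h2 := abs_nonneg (v n ω)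
    simp only [Pi.add_apply, Real.norm_eq_abs]
    nlinarith
  have hv0 : ∀ n, 0 ≤ᵐ[P] v n := fun n => condExp_nonneg (.of_forall fun _ => sq_nonneg _)
  -- The partial sum includes index `k`: `v k` is already measurable for the history at time `k`, so
  -- the events stay adapted.
  set B : ℕ → ℕ → Set Ω := fun K k =>
    {ω | √(v k ω) ≤ K ∧ ∑ j ∈ Finset.range (k + 1), c j * √(v j ω) ≤ K} with hB
  set C : ℕ → ℕ → Set Ω := fun K n => ⋂ k ∈ Finset.range (n + 1), B K k with hCdef
  have hCmem : ∀ K n ω, ω ∈ C K n ↔ ∀ k ≤ n, ω ∈ B K k := fun K n ω => by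
    simp [hCdef]
  have hCm : ∀ K n, MeasurableSet[sigmaUpTo x n] (C K n) := by
    intro K n
    have hm : ∀ j ≤ n, Measurable[sigmaUpTo x n] fun ω => √(v j ω) := fun j hj =>
      ((hvm j).mono (sigmaUpTo_mono x hj) le_rfl).sqrt
    refine Finset.measurableSet_biInter _ fun k hk => ?_
    have hkn : k ≤ n := Nat.lt_succ_iff.1 (Finset.mem_range.1 hk)
    refine MeasurableSet.inter (hm k hkn measurableSet_Iic) ?_
    have : Measurable[sigmaUpTo x n] fun ω => ∑ j ∈ Finset.range (k + 1), c j * √(v j ω) :=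
      Finset.measurable_fun_sum _ fun j hj =>
        (hm j (by have := Finset.mem_range.1 hj; omega)).const_mul _
    exact this measurableSet_Iic
  have hCm' : ∀ K n, MeasurableSet (C K n) := fun K n => hle n _ (hCm K n)
  have hanti : ∀ K, Antitone (C K) := fun K m n hmn ω hω =>
    (hCmem _ _ _).2 fun k hk => (hCmem _ _ _).1 hω k (hk.trans hmn)
  have hcover : ∀ᵐ ω ∂P, ∃ K, ∀ n, ω ∈ C K n := by
    filter_upwards [h0, hs] with ω hω0 hωs
    obtain ⟨b, hb⟩ := hω0.sqrt.bddAbove_range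
    obtain ⟨K, hK⟩ := exists_nat_ge (max b (∑' n, c n * √(v n ω)))
    refine ⟨K, fun n => (hCmem _ _ _).2 fun k _ => ⟨?_, ?_⟩⟩
    · exact le_trans (hb ⟨k, rfl⟩) ((le_max_left _ _).trans hK)
    · exact (hωs.sum_le_tsum _ fun j _ => mul_nonneg (hc0 j) (Real.sqrt_nonneg _)).trans
        ((le_max_right _ _).trans hK)
  have hsum : ∀ K, Summable fun n => c n * ∫ ω in C K n, √(v n ω) ∂P := by
    intro K
    refine summable_of_sum_range_le (c := K)
      (fun n => mul_nonneg (hc0 n) (integral_nonneg fun _ => Real.sqrt_nonneg _)) fun N => ?_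
    -- If `ω` is in the last event, the whole partial sum is at most `K` by definition of `B`;
    -- otherwise the last term vanishes and induction applies.
    have hpt : ∀ ω, ∑ n ∈ Finset.range N,
        (C K n).indicator (fun ω => c n * √(v n ω)) ω ≤ K := by
      intro ω
      induction N with
      | zero => simp
      | succ N ih =>
        by_cases hω : ω ∈ C K N
        · refine le_trans (Finset.sum_le_sum fun n _ => ?_)
            ((hCmem _ _ _).1 hω N le_rfl).2
          exact Set.indicator_le_self' (fun _ _ => mul_nonneg (hc0 n) (Real.sqrt_nonneg _)) ω
        · rw [Finset.sum_range_succ, Set.indicator_of_notMem hω, add_zero]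
          exact ih
    have hii : ∀ n, Integrable ((C K n).indicator fun ω => c n * √(v n ω)) P := fun n =>
      ((hεi n).const_mul _).indicator (hCm' K n)
    calc ∑ n ∈ Finset.range N, c n * ∫ ω in C K n, √(v n ω) ∂P
        = ∫ ω, ∑ n ∈ Finset.range N, (C K n).indicator (fun ω => c n * √(v n ω)) ω ∂P := by
          rw [integral_finsetSum _ fun n _ => hii n]
          refine Finset.sum_congr rfl fun n _ => ?_
          rw [integral_indicator (hCm' K n), integral_const_mul]
      _ ≤ ∫ _, (K : ℝ) ∂P :=
          integral_mono (integrable_finsetSum _ fun n _ => hii n) (integrable_const _) hpt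
      _ = K := by simp
  refine h.ae_summable_error_and_tendsto_residual hz hdiv hCm hanti hcover (fun K => ?_)
    fun K => ?_
  · refine Summable.of_nonneg_of_le (fun n => integral_nonneg_of_ae
      (ae_restrict_of_ae (h.error_nonneg n))) (fun n => ?_) (hsum K)
    rw [h.setIntegral_relax_mul_error n (hCm K n)]
    refine mul_le_mul_of_nonneg_left ?_ (hc0 n)
    rw [← setIntegral_condExp (hle n) ((h.memLp_e n).norm.integrable one_le_two) (hCm K n)]
    exact setIntegral_mono_ae integrable_condExp.integrableOn (hεi n).integrableOn
      (condExp_le_sqrt_condExp_sq (hle n) (h.memLp_e n).norm)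
  · refine Summable.of_nonneg_of_le (fun n => integral_nonneg fun _ => sq_nonneg _)
      (fun n => ?_) ((hsum K).mul_left (1 / α * K))
    rw [h.setIntegral_relax_sq_mul_error_sq n (hCm K n),
      ← setIntegral_condExp (hle n) (h.memLp_e n).norm.integrable_sq (hCm K n)]
    -- The bound `√v ≤ K` on the event turns the second-moment term into the summable first-order
    -- one.
    have h1 : ∫ ω in C K n, v n ω ∂P ≤ K * ∫ ω in C K n, √(v n ω) ∂P := by
      rw [← integral_const_mul]
      refine setIntegral_mono_on_ae (hvi n).integrableOn ((hεi n).const_mul _).integrableOn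
        (hCm' K n) ?_
      filter_upwards [hv0 n] with ω hω hωC
      calc v n ω = √(v n ω) * √(v n ω) := (Real.mul_self_sqrt hω).symm
        _ ≤ K * √(v n ω) :=
          mul_le_mul_of_nonneg_right ((hCmem _ _ _).1 hωC n le_rfl).1 (Real.sqrt_nonneg _)
    have h2 : 0 ≤ ∫ ω in C K n, v n ω ∂P :=
      integral_nonneg_of_ae (ae_restrict_of_ae (hv0 n))
    have hα := h.pos
    calc (∫ ω, μ n ω ^ 2 ∂P) * ∫ ω in C K n, v n ω ∂P
        ≤ (1 / α * c n) * (K * ∫ ω in C K n, √(v n ω) ∂P) :=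
          mul_le_mul (h.integral_relax_sq_le n) h1 h2 (mul_nonneg (by positivity) (hc0 n))
      _ = 1 / α * K * (c n * ∫ ω in C K n, √(v n ω) ∂P) := by ring

/-- The almost sure conclusions under the error conditions in expectation. -/
theorem ae_of_integral_error (h : IsNoisyKM P α T x e μ) (hz : T z = z)
    (hdiv : Tendsto (fun N => ∑ n ∈ Finset.range N, ∫ ω, μ n ω * (1 - α * μ n ω) ∂P) atTop atTop)
    (hs : Summable (fun n => √((∫ ω, μ n ω ^ 2 ∂P) * (∫ ω, ‖e n ω‖ ^ 2 ∂P)))) :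
    ∀ᵐ ω ∂P, (Summable fun n => μ n ω * ‖e n ω‖) ∧
      Tendsto (fun n => ‖T (x n ω) - x n ω‖) atTop (𝓝 0) := by
  have hsq : ∀ n, ∫ ω, (μ n ω * ‖e n ω‖) ^ 2 ∂P =
      √((∫ ω, μ n ω ^ 2 ∂P) * (∫ ω, ‖e n ω‖ ^ 2 ∂P)) ^ 2 := by
    intro n
    rw [Real.sq_sqrt (mul_nonneg (integral_nonneg fun _ => sq_nonneg _)
      (integral_nonneg fun _ => sq_nonneg _))]
    simpa using h.setIntegral_relax_sq_mul_error_sq n (C := Set.univ) MeasurableSet.univ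
  refine h.ae_summable_error_and_tendsto_residual hz hdiv (C := fun _ _ => Set.univ)
    (fun _ _ => MeasurableSet.univ) (fun _ => antitone_const) (by simp) (fun _ => ?_) fun _ => ?_
  · simp only [Measure.restrict_univ]
    refine Summable.of_nonneg_of_le (fun n => integral_nonneg_of_ae (h.error_nonneg n))
      (fun n => ?_) hs
    -- Nonnegative variance supplies `(E f)² ≤ E f²`.
    have h1 := variance_nonneg (fun ω => μ n ω * ‖e n ω‖) P
    rw [variance_eq_sub (h.memLp_error n)] at h1
    have h2 := hsq n
    refine (pow_le_pow_iff_left₀ (integral_nonneg_of_ae (h.error_nonneg n))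
      (Real.sqrt_nonneg _) two_ne_zero).1 ?_
    simp only [Pi.pow_apply] at h1
    linarith
  · simp only [Measure.restrict_univ, hsq]
    refine Summable.of_norm_bounded_eventually_nat hs ?_
    filter_upwards [hs.tendsto_atTop_zero.eventually_le_const zero_lt_one] with n hn
    rw [Real.norm_of_nonneg (sq_nonneg _), sq]
    exact mul_le_of_le_one_left (Real.sqrt_nonneg _) hn

/-- Under the error conditions in expectation, the iterates are dominated in `L²`. -/
theorem exists_memLp_bound (h : IsNoisyKM P α T x e μ) (hz : T z = z)
    (hs : Summable (fun n => √((∫ ω, μ n ω ^ 2 ∂P) * (∫ ω, ‖e n ω‖ ^ 2 ∂P)))) :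
    ∃ D : Ω → ℝ, MemLp D 2 P ∧ ∀ᵐ ω ∂P, ∀ n, ‖x n ω - z‖ ≤ D ω := by
  have hfin : ∑' n, eLpNorm (fun ω => μ n ω * ‖e n ω‖) 2 P ≠ ∞ := by
    simp_rw [h.eLpNorm_error]
    exact hs.tsum_ofReal_ne_top
  have hm : ∀ n, AEStronglyMeasurable (fun ω => μ n ω * ‖e n ω‖) P := fun n =>
    (h.memLp_error n).aestronglyMeasurable
  refine ⟨fun ω => ‖x 0 ω - z‖ + ∑' n, ‖μ n ω * ‖e n ω‖‖,
    (h.memLp_sub hz 0).norm.add (memLp_tsum_norm one_le_two hm hfin), ?_⟩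
  filter_upwards [summable_norm_of_tsum_eLpNorm_ne_top one_le_two hm hfin,
    ae_all_iff.2 h.norm_sub_succ_le] with ω hsum hω n
  refine (le_add_sum_of_le_add (a := fun n => ‖x n ω - z‖)
    (r := fun n => ‖μ n ω * ‖e n ω‖‖)
    (fun n => (hω n z hz).trans (add_le_add_right (le_abs_self _) _)) n).trans ?_
  refine add_le_add_right ?_ _
  exact hsum.sum_le_tsum _ fun _ _ => norm_nonneg _

end IsNoisyKM

theorem AsWeakTendsto.asTendsto_of_demiregular {Ω H : Type*} [MeasurableSpace Ω]
    [NormedAddCommGroup H] [InnerProductSpace ℝ H] {P : Measure Ω} {T : H → H}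
    {x : ℕ → Ω → H} {xlim : Ω → H} (hx : AsWeakTendsto P x xlim)
    (hfix : ∀ ω, xlim ω ∈ Function.fixedPoints T)
    (hres : AsTendsto P (fun n ω => T (x n ω) - x n ω) fun _ => 0)
    (hd : ∀ z ∈ Function.fixedPoints T, DemiregularAt (fun y => T y - y) z) :
    AsTendsto P x xlim := by
  filter_upwards [hx, hres] with ω hω hωr
  refine hd _ (hfix ω) _ hω ?_
  have h0 : T (xlim ω) - xlim ω = 0 := sub_eq_zero.2 (hfix ω)
  simpa only [h0] using hωr

end StochKM

/-! ### The main theorem. -/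

theorem corollary4p3
    {H : Type*} [NormedAddCommGroup H] [InnerProductSpace ℝ H] [CompleteSpace H]
    [TopologicalSpace.SeparableSpace H] [MeasurableSpace H] [BorelSpace H]
    {Ω : Type*} [MeasurableSpace Ω] (P : Measure Ω) [IsProbabilityMeasure P]
    (α : ℝ) (hα : α ∈ Set.Ioo (0 : ℝ) 1)
    (T : H → H) (hT : StochKM.IsAveraged α T) (hFix : (Function.fixedPoints T).Nonempty)
    (x e : ℕ → Ω → H) (μ : ℕ → Ω → ℝ)
    (hx : ∀ n, Measurable (x n)) (hx0 : MemLp (x 0) 2 P)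
    (he : ∀ n, Measurable (e n)) (heL2 : ∀ n, MemLp (e n) 2 P)
    (hμ : ∀ n, Measurable (μ n))
    (hμ_mem : ∀ n, ∀ᵐ ω ∂P, μ n ω ∈ Set.Ioo (0 : ℝ) (1 / α))
    (hrec : ∀ n, ∀ᵐ ω ∂P, x (n + 1) ω = x n ω + μ n ω • (T (x n ω) + e n ω - x n ω))
    (hdiv : Tendsto (fun N => ∑ n ∈ Finset.range N, ∫ ω, μ n ω * (1 - α * μ n ω) ∂P)
      atTop atTop)
    (hind : ∀ n, Indep (MeasurableSpace.comap (μ n) inferInstance)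
      (MeasurableSpace.comap (e n) inferInstance ⊔ StochKM.sigmaUpTo x n) P) :
    ∃ xlim : Ω → H, Measurable xlim ∧ (∀ ω, xlim ω ∈ Function.fixedPoints T) ∧
      -- conditional error conditions
      ((∀ᵐ ω ∂P, Tendsto
          (fun n => (P[fun ω' => ‖e n ω'‖ ^ 2 | StochKM.sigmaUpTo x n]) ω) atTop (𝓝 0)) →
        (∀ᵐ ω ∂P, Summable (fun n => (∫ ω', μ n ω' ∂P) *
          √((P[fun ω' => ‖e n ω'‖ ^ 2 | StochKM.sigmaUpTo x n]) ω))) →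
        StochKM.AsTendsto P (fun n ω => T (x n ω) - x n ω) (fun _ => 0) ∧
        StochKM.AsWeakTendsto P x xlim ∧
        ((∀ z ∈ Function.fixedPoints T, StochKM.DemiregularAt (fun y => T y - y) z) →
          StochKM.AsTendsto P x xlim)) ∧
      -- error conditions in expectation
      (Tendsto (fun n => ∫ ω, ‖e n ω‖ ^ 2 ∂P) atTop (𝓝 0) →
        Summable (fun n => √((∫ ω, μ n ω ^ 2 ∂P) * (∫ ω, ‖e n ω‖ ^ 2 ∂P))) →
        (StochKM.LpTendsto 1 P (fun n ω => T (x n ω) - x n ω) (fun _ => 0) ∧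
          StochKM.AsTendsto P (fun n ω => T (x n ω) - x n ω) (fun _ => 0)) ∧
        (MemLp xlim 2 P ∧ StochKM.L2WeakTendsto P x xlim ∧
          StochKM.AsWeakTendsto P x xlim) ∧
        ((∀ z ∈ Function.fixedPoints T, StochKM.DemiregularAt (fun y => T y - y) z) →
          StochKM.LpTendsto 2 P x xlim ∧ StochKM.AsTendsto P x xlim)) := by
  have h : StochKM.IsNoisyKM P α T x e μ :=
    ⟨hα.1, hT, hx, hx0, he, heL2, hμ, hμ_mem, hrec, hind⟩
  have : SecondCountableTopology H := UniformSpace.secondCountable_of_separable H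
  obtain ⟨z, hz⟩ := id hFix
  -- One `xlim` must serve both sets of error conditions. Each set implies `has`, so if `has` fails
  -- both implications are vacuous and a constant fixed point suffices.
  by_cases has : ∀ᵐ ω ∂P, (Summable fun n => μ n ω * ‖e n ω‖) ∧
      Tendsto (fun n => ‖T (x n ω) - x n ω‖) atTop (𝓝 0)
  swap
  · exact ⟨fun _ => z, measurable_const, fun _ => hz,
      fun h0 hs => (has (h.ae_of_condExp_error hz hdiv h0 hs)).elim,
      fun _ hs => (has (h.ae_of_integral_error hz hdiv hs)).elim⟩
  obtain ⟨xlim, hxm, hxfix, hweak⟩ := h.exists_asWeakTendsto hFix has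
  have hres : StochKM.AsTendsto P (fun n ω => T (x n ω) - x n ω) fun _ => 0 := by
    filter_upwards [has] with ω hω using tendsto_zero_iff_norm_tendsto_zero.2 hω.2
  refine ⟨xlim, hxm, hxfix, fun _ _ => ⟨hres, hweak, hweak.asTendsto_of_demiregular hxfix hres⟩,
    fun _ hs => ?_⟩
  obtain ⟨D, hD, hxD⟩ := h.exists_memLp_bound hz hs
  have hxD' : ∀ᵐ ω ∂P, ∀ n, ‖x n ω‖ ≤ D ω + ‖z‖ := by
    filter_upwards [hxD] with ω hω n
    have := norm_add_le (x n ω - z) z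
    rw [sub_add_cancel] at this
    linarith [hω n]
  have hD' : MemLp (fun ω => D ω + ‖z‖) 2 P := hD.add (memLp_const _)
  have hlimL2 : MemLp xlim 2 P := by
    refine MemLp.mono' hD' hxm.aestronglyMeasurable ?_
    filter_upwards [hxD', hweak] with ω hω hw
    simpa using hw.norm_sub_le (a := 0) (fun n => by simpa using hω n)
  refine ⟨⟨⟨fun n => (h.memLp_residual hz n).mono_exponent one_le_two, MemLp.zero', ?_⟩, hres⟩,
    ⟨hlimL2, ⟨h.memLp hz, hlimL2, fun y hy => ?_⟩, hweak⟩, fun hd => ?_⟩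
  · refine StochKM.tendsto_eLpNorm_sub_of_dominated le_rfl ENNReal.one_ne_top
      (fun n => (h.measurable_residual n).aestronglyMeasurable) MemLp.zero'
      ((hD.mono_exponent one_le_two).const_mul (2 * α)) (fun n => ?_) hres
    filter_upwards [hxD] with ω hω
    refine (hT.norm_residual_le hα.1 hz _).trans ?_
    have := hα.1
    gcongr
    exact hω n
  · refine tendsto_integral_of_dominated_convergence (fun ω => (D ω + ‖z‖) * ‖y ω‖)
      (fun n => (hx n).aestronglyMeasurable.inner hy.aestronglyMeasurable)
      (hD'.integrable_mul hy.norm) (fun n => ?_) ?_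
    · filter_upwards [hxD'] with ω hω
      exact (norm_inner_le_norm _ _).trans (by gcongr; exact hω n)
    · filter_upwards [hweak] with ω hω using hω (y ω)
  · have hstrong := hweak.asTendsto_of_demiregular hxfix hres hd
    refine ⟨⟨h.memLp hz, hlimL2, ?_⟩, hstrong⟩
    exact StochKM.tendsto_eLpNorm_sub_of_dominated one_le_two ENNReal.ofNat_ne_top
      (fun n => (hx n).aestronglyMeasurable) hlimL2 hD'
      (fun n => by filter_upwards [hxD'] with ω hω using hω n) hstrong
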